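/- Let $n \ge 2$ and let $G=([n],\vec E)$ be a digraph without self-loops and without 2-cycles, where $[n]=\{1,\dots,n\}$. For $\ell\in[n]$ let $R_\ell=(r^{(\ell)}_{i,j})_{i\in[n+1],\,j\in\{1,2\}}$ be the pattern generated by $G$ at $\ell$, that is, the $(n+1)\times 2$ matrix with $r^{(\ell)}_{1,1}=r^{(\ell)}_{\ell+1,2}=\ell$, with $r^{(\ell)}_{j,2}=0$ for $j\in[n+1]\setminus\{\ell+1\}$ and, for $j\in[n]$, with $r^{(\ell)}_{j+1,1}=j$ if $(\ell,j)\in\vec E$ and $r^{(\ell)}_{j+1,1}=n+1$ otherwise. Let $N\ge n+1$, let $(U_{m,i}: m\in\mathbb N_0,\ i\in[n+1])$ be i.i.d. random variables uniformly distributed on $[N]$, and let $X_m$ be the $(n+1)\times 2$ matrix with columns $(U_{m,i})_i$ and $(U_{m+1,i})_i$, so that $(X_m)_{m\in\mathbb N_0}$ is the chain $\mathbf X^{(N,n+1)}$. Let $T_\ell=T_{R_\ell}$ be the first $m\in\mathbb N_0$ such that $X_m$ agrees with $R_\ell$ in the whole first column and in row $\ell+1$ of the second column ($T_\ell=\infty$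 if there is no such $m$). Then the hitting times $T_1,\dots,T_n$ are identically distributed, $\mathbb P(T_i=T_j)=0$ for all $i\ne j$, and the family is 2-determined, which means the following. For sets $A,B\subset[n]$ write $A\to B$ if $\mathbb P(T_j<T_i)>\tfrac12$ for all $i\in A$ and $j\in B$ (that is, all pairs $(i,j)\in A\times B$ are arrows of the ranking graph of $T_1,\dots,T_n$). Then for all nonempty disjoint $A,B\subset[n]$ with $A\to B$, the family $\{T_i:i\in B\}$ is small with respect to $\{T_i:i\in A\}$, i.e. $$\frac1{|B|}\sum_{i\in B}p_i \;>\; \frac1{|A|}\sum_{i\in A}p_i,\qquad p_i:=\mathbb P\bigl(T_i\le T_j\ \text{for all } j\in A\cup B\bigr).$$ -/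

import Mathlib

open MeasureTheory ProbabilityTheory

namespace PatternRank

/-! ### Ranking graphs, first-hit probabilities, smallness -/

section Ranking

variable {Ω : Type*} [MeasurableSpace Ω] {α : Type*} [LinearOrder α] {ι : Type*}

/-- The graph has neither self-loops nor 2-cycles (the case `i = j` excludes the loops). -/
def IsOriented (G : Digraph ι) : Prop :=
  ∀ i j, G.Adj i j → ¬ G.Adj j i

/-- `A → B`: every vertex of `A` has an arrow to every vertex of `B`. -/
def PointsTo (G : Digraph ι) (A B : Finset ι) : Prop :=
  ∀ i ∈ A, ∀ j ∈ B, G.Adj i j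

/-- No two members of the family `(S i : i ∈ C)` are equal with positive probability. -/
def NoTie (μ : Measure Ω) (S : ι → Ω → α) (C : Set ι) : Prop :=
  ∀ i ∈ C, ∀ j ∈ C, i ≠ j → μ {ω | S i ω = S j ω} = 0

/-- The ranking graph: `(i, j)` is an arrow iff `P (S j < S i) > 1 / 2`. -/
def rankingGraph (μ : Measure Ω) (S : ι → Ω → α) : Digraph ι where
  Adj i j := 1 / 2 < μ.real {ω | S j ω < S i ω}

/-- `p_i` of the family `(S j : j ∈ C)`: the probability that `S i` is the smallest of them. -/
noncomputable def firstProb (μ : Measure Ω) (S : ι → Ω → α) (C : Finset ι) (i : ι) : ℝ :=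
  μ.real {ω | ∀ j ∈ C, S i ω ≤ S j ω}

/-- For nonempty `A` and `B`: the family `(S i : i ∈ A)` is small with respect to
`(S i : i ∈ B)`. -/
def IsSmall [DecidableEq ι] (μ : Measure Ω) (S : ι → Ω → α) (A B : Finset ι) : Prop :=
  NoTie μ S (A ∪ B : Finset ι) ∧
    (1 / (B.card : ℝ)) * ∑ i ∈ B, firstProb μ S (A ∪ B) i <
      (1 / (A.card : ℝ)) * ∑ i ∈ A, firstProb μ S (A ∪ B) i

/-- The family is 2-determined: whenever `A → B` in its own ranking graph, `(S i : i ∈ B)` is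
small with respect to `(S i : i ∈ A)`. -/
def IsTwoDetermined [DecidableEq ι] (μ : Measure Ω) (S : ι → Ω → α) : Prop :=
  ∀ A B : Finset ι, A.Nonempty → B.Nonempty → Disjoint A B →
    PointsTo (rankingGraph μ S) A B → IsSmall μ S B A

end Ranking

/-! ### The chain -/

section Chain

variable {Ω : Type*}

/-- The entries `U m i` (`m ∈ ℕ`, `i` one of `k` rows) are i.i.d. uniform on `{1, …, N}`. -/
structure IsUniformArray [MeasurableSpace Ω] (μ : Measure Ω) (N : ℕ) {k : ℕ}
    (U : ℕ → Fin k → Ω → ℕ) : Prop where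
  measurable : ∀ m i, Measurable (U m i)
  indep : iIndepFun (fun p : ℕ × Fin k => U p.1 p.2) μ
  uniform : ∀ m i, μ.map (U m i) = uniformOn (Set.Icc 1 N)

/-- The chain `X_m = [U_m, U_{m+1}]`, with values in the `k × 2` matrices. -/
def chain {k : ℕ} (U : ℕ → Fin k → Ω → ℕ) (m : ℕ) (ω : Ω) : Matrix (Fin k) (Fin 2) ℕ :=
  Matrix.of fun i j => U (m + (j : ℕ)) i ω

end Chain

/-! ### Patterns -/

/-- A pattern: a `k × 2` matrix over `{0, …, M}` whose first column has no zero entry and whose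
second column has exactly one nonzero entry. -/
structure Pattern (M k : ℕ) where
  entry : Matrix (Fin k) (Fin 2) ℕ
  fst_mem : ∀ i, entry i 0 ∈ Set.Icc 1 M
  snd_le : ∀ i, entry i 1 ≤ M
  existsUnique_snd : ∃! i, entry i 1 ≠ 0

namespace Pattern

variable {M k : ℕ}

/-- The index of hump: the row of the nonzero entry of the second column. -/
noncomputable def hump (Q : Pattern M k) : Fin k :=
  Q.existsUnique_snd.choose

theorem entry_hump_ne_zero (Q : Pattern M k) : Q.entry Q.hump 1 ≠ 0 :=
  Q.existsUnique_snd.choose_spec.1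

theorem eq_hump (Q : Pattern M k) {i : Fin k} (hi : Q.entry i 1 ≠ 0) : i = Q.hump :=
  Q.existsUnique_snd.choose_spec.2 i hi

end Pattern

/-- The projection `Π_h`: replace by `0` every entry of the second column outside row `h`. -/
def proj {k : ℕ} (h : Fin k) (S : Matrix (Fin k) (Fin 2) ℕ) : Matrix (Fin k) (Fin 2) ℕ :=
  Matrix.of fun i j => if j = 0 ∨ i = h then S i j else 0

/-- The first time `m` at which `Π_{h(R)} (X_m) = R` (`⊤` if there is none). -/
noncomputable def patternTime {Ω : Type*} {M k : ℕ} (U : ℕ → Fin k → Ω → ℕ) (R : Pattern M k) :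
    Ω → ℕ∞ :=
  hittingAfter (chain U) {S | proj R.hump S = R.entry} 0

/-! ### The patterns generated by a graph

The vertex `l : Fin n` stands for the number `l + 1` of `{1, …, n}`. Row `0` is the first row, so
that row `Fin.succ j` belongs to the vertex `j`. -/

open Classical in
/-- The matrix of the pattern generated at the vertex `l`. Its second column has the number of `l`
in the row of `l` and `0` elsewhere. Its first column has the number of `l` in the first row, and
in the row of `j` the number of `j` if `(l, j)` is an arrow and `n + 1` otherwise. -/
noncomputable def generatedEntry {n : ℕ} (G : Digraph (Fin n)) (l : Fin n) :
    Matrix (Fin (n + 1)) (Fin 2) ℕ :=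
  Matrix.of fun i j =>
    if j = 0 then
      Fin.cases ((l : ℕ) + 1) (fun v => if G.Adj l v then (v : ℕ) + 1 else n + 1) i
    else
      if i = l.succ then (l : ℕ) + 1 else 0

/-- The pattern `R_l` generated by `G` at the vertex `l`. -/
noncomputable def generatedPattern {n : ℕ} (G : Digraph (Fin n)) (l : Fin n) :
    Pattern (n + 1) (n + 1) where
  entry := generatedEntry G l
  fst_mem i := by
    have hl := l.isLt
    refine Fin.cases ?_ (fun v => ?_) i
    · simp [generatedEntry]
    · have hv := v.isLt
      by_cases h : G.Adj l v
      · simp [generatedEntry, h]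
      · simp [generatedEntry, h]
  snd_le i := by
    have hl := l.isLt
    by_cases h : i = l.succ
    · simp [generatedEntry, h]
    · simp [generatedEntry, h]
  existsUnique_snd := ⟨l.succ, by simp [generatedEntry], fun i hi => by
    by_contra h
    exact hi (by simp [generatedEntry, h])⟩

end PatternRank

/-!
An occurrence of one pattern immediately after another shares exactly one entry of the array with
it. If the two patterns disagree at that entry this is impossible; otherwise the second occurrence
has conditional probability `q = N⁻ᵏ`, where `k` is the number of rows. Splitting by the first
occurrence of a member of a subfamily `C`, and summing over time, gives the linear system
`p_j + q * ∑ p_i = K` for all `j ∈ C`, the sum being over the out-neighbours `i ∈ C` of `j` in the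
overlap graph, and `K` depending on `C` only.

For `C = {i, j}` the system shows that an arrow of the ranking graph is an arrow of the overlap
graph whose reverse is not. So if `A → B`, then for `C = A ∪ B`, writing `p(B) = ∑_{i ∈ B} p_i`, it
yields `p_i ≤ K - q * p(B)` on `A`, whereas `p_j ≥ K - q * (p(B) - p_j)` on `B`, because `j` has
out-neighbours in `B` only and is not its own out-neighbour. Averaging over `A` and over `B` gives
the strict inequality, since `p(B) > 0`.
-/

namespace PatternRank

section Balance

variable {ι : Type*} {G : Digraph ι} {A B C : Finset ι} {f : ι → ℝ} {i j : ι}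

open Classical in
/-- The total weight, under `f`, of the out-neighbours of `j` in `C`. -/
noncomputable def outMass (G : Digraph ι) (C : Finset ι) (f : ι → ℝ) (j : ι) : ℝ :=
  ∑ i ∈ C with G.Adj j i, f i

theorem sum_le_outMass (hBC : B ⊆ C) (hf : ∀ i ∈ C, 0 ≤ f i) (hj : ∀ i ∈ B, G.Adj j i) :
    ∑ i ∈ B, f i ≤ outMass G C f j := by
  classical
  exact Finset.sum_le_sum_of_subset_of_nonneg
    (fun i hi => Finset.mem_filter.2 ⟨hBC hi, hj i hi⟩)
    fun i hi _ => hf i (Finset.mem_filter.1 hi).1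

theorem outMass_le_sum_sub (hf : ∀ i ∈ B, 0 ≤ f i) (hjB : j ∈ B) (hjj : ¬ G.Adj j j)
    (hj : ∀ i ∈ C, G.Adj j i → i ∈ B) : outMass G C f j ≤ ∑ i ∈ B, f i - f j := by
  classical
  rw [← Finset.sum_erase_eq_sub hjB]
  refine Finset.sum_le_sum_of_subset_of_nonneg (fun i hi => ?_)
    fun i hi _ => hf i (Finset.mem_of_mem_erase hi)
  obtain ⟨hiC, hji⟩ := Finset.mem_filter.1 hi
  exact Finset.mem_erase.2 ⟨fun h => hjj (h ▸ hji), hj i hiC hji⟩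

open Classical in
theorem outMass_pair_left [DecidableEq ι] (hij : i ≠ j) (hii : ¬ G.Adj i i) :
    outMass G {i, j} f i = if G.Adj i j then f j else 0 := by
  rw [outMass, Finset.sum_filter, Finset.sum_pair hij, if_neg hii, zero_add]

theorem mean_lt_mean_of_le_of_add_mul_le (hA : A.Nonempty) (hB : B.Nonempty)
    {q L : ℝ} (hq : 0 < q) (hf : ∀ i ∈ B, 0 ≤ f i) (hpos : 0 < ∑ i ∈ A, f i + ∑ i ∈ B, f i)
    (hfA : ∀ i ∈ A, f i ≤ L) (hfB : ∀ i ∈ B, L + q * f i ≤ f i) :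
    1 / (A.card : ℝ) * ∑ i ∈ A, f i < 1 / (B.card : ℝ) * ∑ i ∈ B, f i := by
  have hcardA : (0 : ℝ) < A.card := mod_cast hA.card_pos
  have hcardB : (0 : ℝ) < B.card := mod_cast hB.card_pos
  have hsumA : ∑ i ∈ A, f i ≤ A.card * L := by
    simpa using Finset.sum_le_card_nsmul A f L hfA
  have hsumB : B.card * L + q * ∑ i ∈ B, f i ≤ ∑ i ∈ B, f i := by
    simpa [Finset.sum_add_distrib, Finset.mul_sum] using Finset.sum_le_sum hfB
  have hposB : 0 < ∑ i ∈ B, f i := by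
    by_contra! h
    have hzero : ∑ i ∈ B, f i = 0 := h.antisymm (Finset.sum_nonneg hf)
    rw [hzero, mul_zero, add_zero] at hsumB
    have hL : L ≤ 0 := nonpos_of_mul_nonpos_right hsumB hcardB
    linarith [mul_nonpos_of_nonneg_of_nonpos hcardA.le hL]
  calc 1 / (A.card : ℝ) * ∑ i ∈ A, f i ≤ L := by
        rwa [one_div_mul_eq_div, div_le_iff₀' hcardA]
    _ < 1 / (B.card : ℝ) * ∑ i ∈ B, f i := by
        rw [one_div_mul_eq_div, lt_div_iff₀' hcardB]
        linarith [mul_pos hq hposB]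

end Balance

section Ranking

variable {Ω ι α : Type*} [MeasurableSpace Ω] {μ : Measure Ω} [LinearOrder α]
  {S : ι → Ω → α} {G : Digraph ι} {q : ℝ}

theorem firstProb_nonneg (C : Finset ι) (i : ι) : 0 ≤ firstProb μ S C i :=
  measureReal_nonneg

theorem measureReal_lt_le_firstProb_pair [IsFiniteMeasure μ] [DecidableEq ι] (i j : ι) :
    μ.real {ω | S j ω < S i ω} ≤ firstProb μ S {i, j} j :=
  measureReal_mono fun ω (hω : S j ω < S i ω) => by simp [hω.le]

theorem sum_firstProb [TopologicalSpace α] [OrderClosedTopology α] [SecondCountableTopology α]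
    [MeasurableSpace α] [OpensMeasurableSpace α] [IsProbabilityMeasure μ] {C : Finset ι}
    (hC : C.Nonempty) (hS : ∀ i ∈ C, Measurable (S i)) (htie : NoTie μ S C) :
    ∑ i ∈ C, firstProb μ S C i = 1 := by
  have hcover : ⋃ i ∈ C, {ω | ∀ j ∈ C, S i ω ≤ S j ω} = Set.univ :=
    Set.eq_univ_of_forall fun ω => by
      simpa using C.exists_min_image (S · ω) hC
  have hdisj : (C : Set ι).Pairwise
      (Function.onFun (AEDisjoint μ) fun i => {ω | ∀ j ∈ C, S i ω ≤ S j ω}) :=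
    fun i hi j hj hij => measure_mono_null
      (fun ω hω => (hω.1 j hj).antisymm (hω.2 i hi)) (htie i hi j hj hij)
  have hmeas : ∀ i ∈ C, MeasurableSet {ω | ∀ j ∈ C, S i ω ≤ S j ω} := fun i hi => by
    simpa only [Set.ofPred_forall] using
      Finset.measurableSet_biInter C fun j hj => measurableSet_le (hS i hi) (hS j hj)
  rw [← probReal_univ (μ := μ), ← hcover,
    measureReal_biUnion_finset₀ hdisj fun i hi => (hmeas i hi).nullMeasurableSet]
  rfl

/-- Within every subfamily, the probability of coming first plus `q` times that of the
out-neighbours in the subfamily is the same for all members. For pattern times this is the linear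
system that determines the first-hit probabilities. -/
def IsBalanced (μ : Measure Ω) (S : ι → Ω → α) (G : Digraph ι) (q : ℝ) : Prop :=
  ∀ C : Finset ι, ∃ K, ∀ j ∈ C, firstProb μ S C j + q * outMass G C (firstProb μ S C) j = K

theorem IsBalanced.adj_and_not_adj_of_rankingGraph_adj [IsFiniteMeasure μ] [DecidableEq ι]
    (hS : IsBalanced μ S G q) (hG : ∀ i, ¬ G.Adj i i) (hq : 0 < q) (hq1 : q < 1) {i j : ι}
    (hij : i ≠ j) (hsum : ∑ l ∈ {i, j}, firstProb μ S {i, j} l = 1)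
    (h : (rankingGraph μ S).Adj i j) : G.Adj i j ∧ ¬ G.Adj j i := by
  classical
  set f := firstProb μ S {i, j}
  obtain ⟨K, hK⟩ := hS {i, j}
  have hi : f i + q * (if G.Adj i j then f j else 0) = K := by
    rw [← outMass_pair_left hij (hG i)]
    exact hK i (by simp)
  have hj : f j + q * (if G.Adj j i then f i else 0) = K := by
    rw [← outMass_pair_left hij.symm (hG j), Finset.pair_comm]
    exact hK j (by simp)
  have hlt : f i < f j := by
    have hhalf : 1 / 2 < f j := lt_of_lt_of_le h (measureReal_lt_le_firstProb_pair i j)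
    rw [Finset.sum_pair hij] at hsum
    linarith
  have hfi : 0 ≤ f i := firstProb_nonneg _ _
  have hadj : G.Adj i j := by
    by_contra hadj
    have hmass : 0 ≤ q * (if G.Adj j i then f i else 0) := by split_ifs <;> positivity
    rw [if_neg hadj] at hi
    linarith
  refine ⟨hadj, fun hadj' => ?_⟩
  rw [if_pos hadj] at hi
  rw [if_pos hadj'] at hj
  linarith [mul_lt_mul_of_pos_right hq1 (sub_pos.2 hlt)]

theorem IsBalanced.isTwoDetermined [DecidableEq ι] [TopologicalSpace α] [OrderClosedTopology α]
    [SecondCountableTopology α] [MeasurableSpace α] [OpensMeasurableSpace α]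
    [IsProbabilityMeasure μ] (hS : IsBalanced μ S G q) (hmeas : ∀ i, Measurable (S i))
    (htie : NoTie μ S Set.univ) (hG : ∀ i, ¬ G.Adj i i) (hq : 0 < q) (hq1 : q < 1) :
    IsTwoDetermined μ S := by
  intro A B hA hB hAB hpoints
  have htie' : ∀ C : Finset ι, NoTie μ S C := fun C i _ j _ => htie i trivial j trivial
  have hsum : ∀ C : Finset ι, C.Nonempty → ∑ i ∈ C, firstProb μ S C i = 1 :=
    fun C hC => sum_firstProb hC (fun i _ => hmeas i) (htie' C)
  have hadj : ∀ i ∈ A, ∀ j ∈ B, G.Adj i j ∧ ¬ G.Adj j i := fun i hi j hj =>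
    hS.adj_and_not_adj_of_rankingGraph_adj hG hq hq1 (Finset.disjoint_iff_ne.1 hAB i hi j hj)
      (hsum _ (Finset.insert_nonempty i {j})) (hpoints i hi j hj)
  obtain ⟨K, hK⟩ := hS (A ∪ B)
  refine ⟨htie' _, ?_⟩
  rw [Finset.union_comm B A]
  set f := firstProb μ S (A ∪ B)
  have hf : ∀ i, 0 ≤ f i := firstProb_nonneg _
  have hfA : ∀ i ∈ A, f i ≤ K - q * ∑ j ∈ B, f j := fun i hi => by
    have hout : ∑ j ∈ B, f j ≤ outMass G (A ∪ B) f i :=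
      sum_le_outMass Finset.subset_union_right (fun j _ => hf j) fun j hj => (hadj i hi j hj).1
    linarith [hK i (Finset.mem_union_left B hi), mul_le_mul_of_nonneg_left hout hq.le]
  have hfB : ∀ j ∈ B, K - q * ∑ i ∈ B, f i + q * f j ≤ f j := fun j hj => by
    have hout : outMass G (A ∪ B) f j ≤ ∑ i ∈ B, f i - f j :=
      outMass_le_sum_sub (fun i _ => hf i) hj (hG j) fun i hi hji =>
        (Finset.mem_union.1 hi).resolve_left fun hiA => (hadj i hiA j hj).2 hji
    linarith [hK j (Finset.mem_union_right A hj), mul_le_mul_of_nonneg_left hout hq.le]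
  refine mean_lt_mean_of_le_of_add_mul_le hA hB hq (fun i _ => hf i) ?_ hfA hfB
  rw [← Finset.sum_union hAB, hsum _ (hA.mono Finset.subset_union_left)]
  exact one_pos

end Ranking

section FirstTime

variable {Ω : Type*}

/-- The first time at which one of the events `E m` occurs (`⊤` if none does). -/
noncomputable def firstTime (E : ℕ → Set Ω) (ω : Ω) : ℕ∞ :=
  ⨅ (m : ℕ) (_ : ω ∈ E m), (m : ℕ∞)

variable {E : ℕ → Set Ω} {ω : Ω}

theorem natCast_le_firstTime {k : ℕ} : (k : ℕ∞) ≤ firstTime E ω ↔ ∀ t < k, ω ∉ E t := by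
  simp only [firstTime, le_iInf_iff, Nat.cast_le]
  exact forall_congr' fun t => by rw [← not_lt, imp_not_comm]

theorem firstTime_eq_natCast {k : ℕ} :
    firstTime E ω = k ↔ ω ∈ E k ∧ (k : ℕ∞) ≤ firstTime E ω := by
  have hsucc : ((k + 1 : ℕ) : ℕ∞) ≤ firstTime E ω ↔ (k : ℕ∞) ≤ firstTime E ω ∧ ω ∉ E k := by
    simp only [natCast_le_firstTime, Nat.forall_lt_succ_right]
  have heq : firstTime E ω = k ↔
      (k : ℕ∞) ≤ firstTime E ω ∧ ¬ ((k + 1 : ℕ) : ℕ∞) ≤ firstTime E ω := by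
    cases firstTime E ω with
    | top => simp
    | coe a => norm_cast; omega
  rw [heq, hsucc]
  tauto

theorem hittingAfter_zero_eq_firstTime {β : Type*} (u : ℕ → Ω → β) (s : Set β) :
    hittingAfter u s 0 = firstTime fun m => u m ⁻¹' s := by
  funext ω
  refine ENat.eq_of_forall_natCast_le_iff fun k => ?_
  rw [natCast_le_firstTime]
  refine not_lt.symm.trans ((not_congr hittingAfter_lt_iff).trans ?_)
  simp

instance : BorelSpace ℕ∞ :=
  ⟨borel_eq_top_of_countable.symm⟩

theorem measurable_firstTime [MeasurableSpace Ω] (hE : ∀ m, MeasurableSet (E m)) :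
    Measurable (firstTime E) := by
  refine measurable_of_Iio fun a => ?_
  have hpre : firstTime E ⁻¹' Set.Iio a = ⋃ (m : ℕ) (_ : (m : ℕ∞) < a), E m := by
    ext ω
    simp [firstTime, iInf_lt_iff, and_comm]
  rw [hpre]
  exact .iUnion fun m => .iUnion fun _ => hE m

end FirstTime

section FirstHit

variable {Ω ι : Type*}

/-- No event of the family `C` occurs before time `k`. -/
def noHit (E : ι → ℕ → Set Ω) (C : Finset ι) (k : ℕ) : Set Ω :=
  {ω | ∀ t < k, ∀ c ∈ C, ω ∉ E c t}

/-- At time `k` the event `E i k` occurs, and no event of the family `C` occurs before. The index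
`i` need not belong to `C`. -/
def firstHit (E : ι → ℕ → Set Ω) (C : Finset ι) (i : ι) (k : ℕ) : Set Ω :=
  E i k ∩ noHit E C k

variable {E : ι → ℕ → Set Ω} {C : Finset ι}

theorem noHit_zero : noHit E C 0 = Set.univ := by
  simp [noHit]

theorem mem_noHit_iff {k : ℕ} {ω : Ω} :
    ω ∈ noHit E C k ↔ ∀ c ∈ C, (k : ℕ∞) ≤ firstTime (E c) ω := by
  simp only [noHit, Set.mem_ofPred_eq, natCast_le_firstTime]
  tauto

theorem mem_firstHit_iff {i : ι} (hi : i ∈ C) {k : ℕ} {ω : Ω} :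
    ω ∈ firstHit E C i k ↔
      firstTime (E i) ω = k ∧ ∀ j ∈ C, firstTime (E i) ω ≤ firstTime (E j) ω := by
  rw [firstHit, Set.mem_inter_iff, mem_noHit_iff]
  constructor
  · rintro ⟨hE, hC⟩
    have hk := firstTime_eq_natCast.2 ⟨hE, hC i hi⟩
    exact ⟨hk, fun j hj => hk.trans_le (hC j hj)⟩
  · rintro ⟨hk, hmin⟩
    exact ⟨(firstTime_eq_natCast.1 hk).1, fun j hj => hk.symm.trans_le (hmin j hj)⟩

theorem measurableSet_noHit {m : MeasurableSpace Ω} {k : ℕ}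
    (hE : ∀ t < k, ∀ c ∈ C, MeasurableSet (E c t)) : MeasurableSet (noHit E C k) := by
  have h : noHit E C k = ⋂ t ∈ Finset.range k, ⋂ c ∈ C, (E c t)ᶜ := by
    ext ω
    simp [noHit]
  rw [h]
  exact Finset.measurableSet_biInter _ fun t ht =>
    Finset.measurableSet_biInter _ fun c hc => (hE t (Finset.mem_range.1 ht) c hc).compl

theorem measurableSet_firstHit [MeasurableSpace Ω] {i : ι} {k : ℕ}
    (hi : MeasurableSet (E i k)) (hE : ∀ t < k, ∀ c ∈ C, MeasurableSet (E c t)) :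
    MeasurableSet (firstHit E C i k) :=
  hi.inter (measurableSet_noHit hE)

theorem noHit_succ (k : ℕ) : noHit E C (k + 1) = noHit E C k \ ⋃ i ∈ C, E i k := by
  ext ω
  simp only [noHit, Nat.forall_lt_succ_right, Set.mem_ofPred_eq, Set.mem_sdiff, Set.mem_iUnion,
    exists_prop, not_exists, not_and]

theorem pairwise_disjoint_firstHit {i : ι} (hi : i ∈ C) :
    Pairwise (Function.onFun Disjoint (firstHit E C i)) := fun k l hkl =>
  Set.disjoint_left.2 fun _ hk hl => hkl <| by
    exact_mod_cast ((mem_firstHit_iff hi).1 hk).1.symm.trans ((mem_firstHit_iff hi).1 hl).1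

theorem measureReal_noHit_inter [MeasurableSpace Ω] {μ : Measure Ω} [IsFiniteMeasure μ]
    (hE : ∀ i ∈ C, ∀ m, MeasurableSet (E i m)) {k : ℕ}
    (hdisj : (C : Set ι).PairwiseDisjoint (E · k)) {s : Set Ω} (hs : MeasurableSet s) :
    μ.real (noHit E C k ∩ s) =
      μ.real (noHit E C (k + 1) ∩ s) + ∑ i ∈ C, μ.real (firstHit E C i k ∩ s) := by
  have hunion : ⋃ i ∈ C, firstHit E C i k ∩ s = noHit E C k ∩ s ∩ ⋃ i ∈ C, E i k := by
    ext ω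
    simp only [firstHit, Set.mem_iUnion, Set.mem_inter_iff, exists_prop]
    tauto
  have hfirst : μ.real (noHit E C k ∩ s ∩ ⋃ i ∈ C, E i k) =
      ∑ i ∈ C, μ.real (firstHit E C i k ∩ s) := by
    rw [← hunion]
    refine measureReal_biUnion_finset
      (hdisj.mono fun i => Set.inter_subset_left.trans Set.inter_subset_left) fun i hi => ?_
    exact (measurableSet_firstHit (hE i hi k) fun t _ c hc => hE c hc t).inter hs
  have hrest : noHit E C (k + 1) ∩ s = (noHit E C k ∩ s) \ ⋃ i ∈ C, E i k := by
    rw [noHit_succ, Set.inter_sdiff_right_comm]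
  rw [← hfirst, hrest, add_comm]
  exact (measureReal_inter_add_sdiff
    (Finset.measurableSet_biUnion C fun i hi => hE i hi k)).symm

end FirstHit

section Renewal

open Filter Topology

variable {Ω ι : Type*} [MeasurableSpace Ω] {μ : Measure Ω} {E : ι → ℕ → Set Ω} {G : Digraph ι}
  {p q : ℝ}

/-- Event families with one-step overlaps: `E j (k + 1)` has probability `p` and is independent of
what happened before time `k`; right after a first hit of `i` at time `k` it has conditional
probability `q` if `(j, i)` is an arrow of `G`, and it is impossible otherwise. -/
structure IsRenewalFamily (μ : Measure Ω) (E : ι → ℕ → Set Ω) (G : Digraph ι) (p q : ℝ) :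
    Prop where
  measurableSet : ∀ i m, MeasurableSet (E i m)
  pairwise_disjoint : ∀ m, Pairwise (Function.onFun Disjoint (E · m))
  measureReal_zero : ∀ i, μ.real (E i 0) = p
  measureReal_noHit_inter : ∀ (C : Finset ι) (j : ι) (k : ℕ),
    μ.real (noHit E C k ∩ E j (k + 1)) = μ.real (noHit E C k) * p
  measureReal_firstHit_inter : ∀ (C : Finset ι) {i j : ι} (k : ℕ), G.Adj j i →
    μ.real (firstHit E C i k ∩ E j (k + 1)) = q * μ.real (firstHit E C i k)
  disjoint_succ : ∀ {i j : ι} (k : ℕ), ¬ G.Adj j i → Disjoint (E i k) (E j (k + 1))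

namespace IsRenewalFamily

variable (hE : IsRenewalFamily μ E G p q) {C : Finset ι} {i j : ι}

include hE

theorem measurable_firstTime (i : ι) : Measurable (firstTime (E i)) :=
  PatternRank.measurable_firstTime (hE.measurableSet i)

theorem measurableSet_firstHit (C : Finset ι) (i : ι) (k : ℕ) :
    MeasurableSet (firstHit E C i k) :=
  PatternRank.measurableSet_firstHit (hE.measurableSet i k) fun t _ c _ => hE.measurableSet c t

variable [IsFiniteMeasure μ]

theorem measureReal_noHit (C : Finset ι) (k : ℕ) :
    μ.real (noHit E C k) = μ.real (noHit E C (k + 1)) + ∑ i ∈ C, μ.real (firstHit E C i k) := by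
  simpa only [Set.inter_univ] using PatternRank.measureReal_noHit_inter
    (fun i _ => hE.measurableSet i) ((hE.pairwise_disjoint k).set_pairwise _) MeasurableSet.univ

theorem renewal (C : Finset ι) (j : ι) (k : ℕ) :
    μ.real (noHit E C k) * p = μ.real (firstHit E C j (k + 1)) +
      q * outMass G C (fun i => μ.real (firstHit E C i k)) j := by
  classical
  have hstep : ∀ i, μ.real (firstHit E C i k ∩ E j (k + 1)) =
      if G.Adj j i then q * μ.real (firstHit E C i k) else 0 := fun i => by
    split_ifs with hji
    · exact hE.measureReal_firstHit_inter C k hji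
    · rw [firstHit, Set.inter_right_comm, (hE.disjoint_succ k hji).inter_eq, Set.empty_inter,
        measureReal_empty]
  rw [← hE.measureReal_noHit_inter C j k, PatternRank.measureReal_noHit_inter
    (fun i _ => hE.measurableSet i) ((hE.pairwise_disjoint k).set_pairwise _)
    (hE.measurableSet j (k + 1)), Set.inter_comm, ← firstHit, outMass, Finset.mul_sum,
    Finset.sum_filter]
  simp only [hstep]

theorem summable_measureReal_firstHit (hi : i ∈ C) :
    Summable fun k => μ.real (firstHit E C i k) :=
  summable_measure_toReal (hE.measurableSet_firstHit C i) (pairwise_disjoint_firstHit hi)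

theorem tendsto_measureReal_noHit (hp : 0 < p) (hC : C.Nonempty) :
    Tendsto (fun k => μ.real (noHit E C k)) atTop (𝓝 0) := by
  classical
  obtain ⟨j, hj⟩ := hC
  have hfirst : ∀ i ∈ C, Tendsto (fun k => μ.real (firstHit E C i k)) atTop (𝓝 0) :=
    fun i hi => (hE.summable_measureReal_firstHit hi).tendsto_atTop_zero
  have hmass : Tendsto (fun k => outMass G C (fun i => μ.real (firstHit E C i k)) j)
      atTop (𝓝 0) := by
    simpa only [outMass, Finset.sum_const_zero] using
      tendsto_finsetSum _ fun i hi => hfirst i (Finset.mem_filter.1 hi).1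
  have hmul : Tendsto (fun k => μ.real (noHit E C k) * p) atTop (𝓝 0) := by
    simp only [hE.renewal C j]
    simpa using ((hfirst j hj).comp (tendsto_add_atTop_nat 1)).add (hmass.const_mul q)
  simpa [mul_div_cancel_right₀ _ hp.ne'] using hmul.div_const p

theorem ae_firstTime_ne_top (hp : 0 < p) (i : ι) : ∀ᵐ ω ∂μ, firstTime (E i) ω ≠ ⊤ := by
  rw [ae_iff, ← measureReal_eq_zero_iff]
  refine le_antisymm (ge_of_tendsto'
    (hE.tendsto_measureReal_noHit hp (Finset.singleton_nonempty i)) fun k => ?_) measureReal_nonneg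
  refine measureReal_mono fun ω hω => mem_noHit_iff.2 fun c hc => ?_
  rw [Finset.mem_singleton.1 hc, not_not.1 hω]
  exact le_top

theorem noTie (hp : 0 < p) (C : Set ι) : NoTie μ (fun i => firstTime (E i)) C := by
  intro i _ j _ hij
  refine measure_mono_null (fun ω hω => ?_) (ae_iff.1 (hE.ae_firstTime_ne_top hp i))
  intro hi
  obtain ⟨k, hk⟩ := ENat.ne_top_iff_exists.1 hi
  have hEi : ω ∈ E i k := (firstTime_eq_natCast.1 hk.symm).1
  have hEj : ω ∈ E j k := (firstTime_eq_natCast.1 (hω.symm.trans hk.symm)).1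
  exact Set.disjoint_left.1 (hE.pairwise_disjoint k hij) hEi hEj

theorem hasSum_measureReal_firstHit (hp : 0 < p) (hi : i ∈ C) :
    HasSum (fun k => μ.real (firstHit E C i k))
      (firstProb μ (fun i => firstTime (E i)) C i) := by
  have hunion : firstProb μ (fun i => firstTime (E i)) C i =
      μ.real (⋃ k, firstHit E C i k) := by
    refine measureReal_congr ?_
    filter_upwards [hE.ae_firstTime_ne_top hp i] with ω hω
    obtain ⟨k, hk⟩ := ENat.ne_top_iff_exists.1 hω
    refine propext (Iff.trans ?_ Set.mem_iUnion.symm)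
    simp only [mem_firstHit_iff hi]
    exact ⟨fun hmin => ⟨k, hk.symm, hmin⟩, fun ⟨_, _, hmin⟩ => hmin⟩
  have htsum := measure_iUnion (μ := μ) (pairwise_disjoint_firstHit hi)
    (hE.measurableSet_firstHit C i)
  rw [hunion, measureReal_def, htsum, ENNReal.tsum_toReal_eq fun _ => measure_ne_top μ _]
  exact (hE.summable_measureReal_firstHit hi).hasSum

theorem isBalanced (hp : 0 < p) : IsBalanced μ (fun i => firstTime (E i)) G q := by
  classical
  intro C
  refine ⟨p + ∑' k, μ.real (noHit E C k) * p, fun j hj => ?_⟩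
  have hfirst := (hasSum_nat_add_iff' 1).2 (hE.hasSum_measureReal_firstHit hp hj)
  have hmass : HasSum (fun k => outMass G C (fun i => μ.real (firstHit E C i k)) j)
      (outMass G C (firstProb μ (fun i => firstTime (E i)) C) j) :=
    hasSum_sum fun i hi => hE.hasSum_measureReal_firstHit hp (Finset.mem_filter.1 hi).1
  have hsum := hfirst.add (hmass.mul_left q)
  simp only [← hE.renewal C j] at hsum
  have hzero : μ.real (firstHit E C j 0) = p := by
    rw [firstHit, noHit_zero, Set.inter_univ, hE.measureReal_zero]
  rw [hsum.tsum_eq, Finset.sum_range_one, hzero]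
  ring

theorem measureReal_noHit_singleton_eq (hi : ¬ G.Adj i i) (hj : ¬ G.Adj j j) (k : ℕ) :
    μ.real (noHit E {i} k) = μ.real (noHit E {j} k) := by
  have hone : ∀ l, μ.real (noHit E {l} 1) = μ.real Set.univ - p := fun l => by
    have h := hE.measureReal_noHit {l} 0
    rw [Finset.sum_singleton, firstHit, noHit_zero, Set.inter_univ,
      hE.measureReal_zero] at h
    linarith
  have hrec : ∀ l, ¬ G.Adj l l → ∀ m, μ.real (noHit E {l} (m + 2)) =
      μ.real (noHit E {l} (m + 1)) - μ.real (noHit E {l} m) * p := fun l hl m => by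
    have hstep := hE.measureReal_noHit {l} (m + 1)
    have hren := hE.renewal {l} l m
    rw [outMass, Finset.filter_singleton, if_neg hl, Finset.sum_empty] at hren
    rw [Finset.sum_singleton] at hstep
    linarith
  induction k using Nat.twoStepInduction with
  | zero => simp only [noHit_zero]
  | one => rw [hone, hone]
  | more m ih ih' => rw [hrec i hi, hrec j hj, ih, ih']

theorem identDistrib (hp : 0 < p) (hi : ¬ G.Adj i i) (hj : ¬ G.Adj j j) :
    IdentDistrib (firstTime (E i)) (firstTime (E j)) μ μ := by
  refine ⟨(hE.measurable_firstTime i).aemeasurable, (hE.measurable_firstTime j).aemeasurable,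
    ?_⟩
  refine Measure.ext_of_Ici _ _ fun a => ?_
  rw [Measure.map_apply (hE.measurable_firstTime i) measurableSet_Ici,
    Measure.map_apply (hE.measurable_firstTime j) measurableSet_Ici]
  cases a with
  | top =>
    have htop : ∀ l, μ (firstTime (E l) ⁻¹' Set.Ici ⊤) = 0 := fun l => by
      simpa [ae_iff, Set.preimage] using hE.ae_firstTime_ne_top hp l
    rw [htop, htop]
  | coe k =>
    have hnoHit : ∀ l, firstTime (E l) ⁻¹' Set.Ici (k : ℕ∞) = noHit E {l} k := fun l => by
      ext ω
      simp [mem_noHit_iff]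
    rw [hnoHit, hnoHit]
    exact (measureReal_eq_measureReal_iff).1 (hE.measureReal_noHit_singleton_eq hi hj k)

end IsRenewalFamily

end Renewal

section Cylinder

variable {Ω κ β : Type*} {X : κ → Ω → β} {A B : Set κ} {s t : Set Ω}

/-- The event that each `X p` with `p ∈ P` takes the value `c p`. -/
def cylinder (X : κ → Ω → β) (P : Finset κ) (c : κ → β) : Set Ω :=
  ⋂ p ∈ P, X p ⁻¹' {c p}

theorem mem_cylinder {P : Finset κ} {c : κ → β} {ω : Ω} :
    ω ∈ cylinder X P c ↔ ∀ p ∈ P, X p ω = c p := by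
  simp [cylinder]

variable [MeasurableSpace β]

/-- The σ-algebra generated by the variables `X p` with `p ∈ A`. -/
abbrev coordSigma (X : κ → Ω → β) (A : Set κ) : MeasurableSpace Ω :=
  ⨆ p ∈ A, MeasurableSpace.comap (X p) inferInstance

theorem measurableSet_coordSigma_cylinder [MeasurableSingletonClass β] {P : Finset κ}
    (hP : ∀ p ∈ P, p ∈ A) (c : κ → β) : MeasurableSet[coordSigma X A] (cylinder X P c) := by
  refine @Finset.measurableSet_biInter _ _ (coordSigma X A) _ P fun p hp => ?_
  have hle : MeasurableSpace.comap (X p) inferInstance ≤ coordSigma X A :=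
    le_iSup₂_of_le p (hP p hp) le_rfl
  exact hle _ ⟨{c p}, measurableSet_singleton _, rfl⟩

variable [MeasurableSpace Ω] {μ : Measure Ω}

theorem coordSigma_le (hX : ∀ p, Measurable (X p)) (A : Set κ) :
    coordSigma X A ≤ ‹MeasurableSpace Ω› :=
  iSup₂_le fun p _ => (hX p).comap_le

theorem measureReal_inter_of_disjoint_coord (hX : ∀ p, Measurable (X p)) (hind : iIndepFun X μ)
    (hAB : Disjoint A B) (hs : MeasurableSet[coordSigma X A] s)
    (ht : MeasurableSet[coordSigma X B] t) : μ.real (s ∩ t) = μ.real s * μ.real t := by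
  have hindep : Indep (coordSigma X A) (coordSigma X B) μ :=
    indep_iSup_of_disjoint (fun p => (hX p).comap_le) hind.iIndep hAB
  simp only [measureReal_def, (Indep_iff _ _ _).1 hindep s t hs ht, ENNReal.toReal_mul]

theorem measureReal_cylinder [MeasurableSingletonClass β] (hind : iIndepFun X μ) {P : Finset κ}
    {c : κ → β} {a : ℝ} (hc : ∀ p ∈ P, μ.real (X p ⁻¹' {c p}) = a) :
    μ.real (cylinder X P c) = a ^ P.card := by
  rw [measureReal_def, cylinder,
    hind.measure_inter_preimage_eq_mul P fun p _ => measurableSet_singleton (c p),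
    ENNReal.toReal_prod, ← Finset.prod_const]
  exact Finset.prod_congr rfl hc

theorem IsUniformArray.measureReal_preimage_singleton {N k : ℕ} {U : ℕ → Fin k → Ω → ℕ}
    (hU : IsUniformArray μ N U) (m : ℕ) (i : Fin k) {v : ℕ} (hv : v ∈ Set.Icc 1 N) :
    μ.real (U m i ⁻¹' {v}) = (N : ℝ)⁻¹ := by
  rw [← map_measureReal_apply (hU.measurable m i) (measurableSet_singleton v), hU.uniform,
    measureReal_def, ← Finset.coe_Icc, ← Finset.coe_singleton, uniformOn_apply_finset,
    Finset.inter_singleton_of_mem (Finset.mem_Icc.2 hv)]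
  simp

end Cylinder

section Occurrence

variable {Ω ι : Type*} {M N k : ℕ} {U : ℕ → Fin k → Ω → ℕ} {R R' : Pattern M k} {m : ℕ}

/-- The event that the pattern `R` occurs at time `m`. -/
def occurrence (U : ℕ → Fin k → Ω → ℕ) (R : Pattern M k) (m : ℕ) : Set Ω :=
  {ω | proj R.hump (chain U m ω) = R.entry}

theorem patternTime_eq_firstTime : patternTime U R = firstTime (occurrence U R) :=
  hittingAfter_zero_eq_firstTime _ _

theorem mem_occurrence_iff {ω : Ω} :
    ω ∈ occurrence U R m ↔
      (∀ r, U m r ω = R.entry r 0) ∧ U (m + 1) R.hump ω = R.entry R.hump 1 := by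
  rw [occurrence, Set.mem_ofPred_eq, ← Matrix.ext_iff]
  simp only [Fin.forall_fin_two, proj, chain, Matrix.of_apply, forall_and]
  refine and_congr (by simp) ⟨fun h => by simpa using h R.hump, fun h r => ?_⟩
  by_cases hr : r = R.hump
  · simpa [hr] using h
  · have hzero : R.entry r 1 = 0 := not_not.1 fun hne => hr (R.eq_hump hne)
    simp [hr, hzero]

/-- The digraph with an arrow `(j, i)` when an occurrence of `R i` can be followed by an occurrence
of `R j` one step later. -/
def overlapGraph (R : ι → Pattern M k) : Digraph ι where
  Adj j i := (R j).entry (R i).hump 0 = (R i).entry (R i).hump 1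

theorem disjoint_occurrence (h : (R.entry · 0) ≠ (R'.entry · 0)) :
    Disjoint (occurrence U R m) (occurrence U R' m) :=
  Set.disjoint_left.2 fun _ hR hR' => h <| funext fun r =>
    ((mem_occurrence_iff.1 hR).1 r).symm.trans ((mem_occurrence_iff.1 hR').1 r)

theorem disjoint_occurrence_succ (h : R'.entry R.hump 0 ≠ R.entry R.hump 1) :
    Disjoint (occurrence U R m) (occurrence U R' (m + 1)) :=
  Set.disjoint_left.2 fun _ hR hR' => h <|
    ((mem_occurrence_iff.1 hR').1 R.hump).symm.trans (mem_occurrence_iff.1 hR).2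

/-- The positions of the array that decide whether a pattern with hump `h` occurs at time `m`. -/
def occurrencePositions (h : Fin k) (m : ℕ) : Finset (ℕ × Fin k) :=
  insert (m + 1, h) ({m} ×ˢ Finset.univ)

theorem mem_occurrencePositions {h : Fin k} {p : ℕ × Fin k} :
    p ∈ occurrencePositions h m ↔ p = (m + 1, h) ∨ p.1 = m := by
  simp only [occurrencePositions, Finset.mem_insert, Finset.mem_product, Finset.mem_singleton,
    Finset.mem_univ, and_true]

theorem card_occurrencePositions (h : Fin k) (m : ℕ) :
    (occurrencePositions h m).card = k + 1 := by
  rw [occurrencePositions, Finset.card_insert_of_notMem (by simp)]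
  simp

theorem le_fst_of_mem_occurrencePositions {h : Fin k} {p : ℕ × Fin k}
    (hp : p ∈ occurrencePositions h m) : m ≤ p.1 := by
  rcases mem_occurrencePositions.1 hp with rfl | rfl
  exacts [m.le_succ, le_rfl]

/-- The value that `R`, occurring at time `m`, prescribes at the position `p`; meaningful only for
`p ∈ occurrencePositions R.hump m`. -/
noncomputable def occurrenceValue (R : Pattern M k) (m : ℕ) (p : ℕ × Fin k) : ℕ :=
  if p.1 = m then R.entry p.2 0 else R.entry R.hump 1

theorem occurrenceValue_mem_Icc (p : ℕ × Fin k) : occurrenceValue R m p ∈ Set.Icc 1 M := by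
  unfold occurrenceValue
  split_ifs
  · exact R.fst_mem p.2
  · exact ⟨Nat.one_le_iff_ne_zero.2 R.entry_hump_ne_zero, R.snd_le R.hump⟩

theorem occurrence_eq_cylinder (R : Pattern M k) (m : ℕ) :
    occurrence U R m =
      cylinder (Function.uncurry U) (occurrencePositions R.hump m) (occurrenceValue R m) := by
  ext ω
  rw [mem_occurrence_iff, mem_cylinder]
  refine ⟨fun ⟨hfst, hsnd⟩ p hp => ?_, fun h => ⟨fun r => ?_, ?_⟩⟩
  · rcases mem_occurrencePositions.1 hp with rfl | rfl
    · simpa [occurrenceValue] using hsnd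
    · exact (hfst p.2).trans (if_pos rfl).symm
  · simpa [occurrenceValue] using h (m, r) (mem_occurrencePositions.2 (.inr rfl))
  · simpa [occurrenceValue] using h (m + 1, R.hump) (mem_occurrencePositions.2 (.inl rfl))

theorem measurableSet_coordSigma_occurrence {A : Set (ℕ × Fin k)}
    (hA : ∀ p ∈ occurrencePositions R.hump m, p ∈ A) :
    MeasurableSet[coordSigma (Function.uncurry U) A] (occurrence U R m) := by
  rw [occurrence_eq_cylinder]
  exact measurableSet_coordSigma_cylinder hA _

theorem measurableSet_coordSigma_noHit {R : ι → Pattern M k} (C : Finset ι) (m : ℕ) :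
    MeasurableSet[coordSigma (Function.uncurry U) {p | p.1 ≤ m}]
      (noHit (fun i => occurrence U (R i)) C m) := by
  refine measurableSet_noHit fun t ht c _ => measurableSet_coordSigma_occurrence fun p hp => ?_
  rcases mem_occurrencePositions.1 hp with rfl | rfl
  exacts [ht, ht.le]

theorem measurableSet_coordSigma_firstHit {R : ι → Pattern M k} (C : Finset ι) (i : ι) (m : ℕ) :
    MeasurableSet[coordSigma (Function.uncurry U) {p | p.1 ≤ m ∨ p = (m + 1, (R i).hump)}]
      (firstHit (fun i => occurrence U (R i)) C i m) := by
  have hle : coordSigma (Function.uncurry U) {p | p.1 ≤ m} ≤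
      coordSigma (Function.uncurry U) {p | p.1 ≤ m ∨ p = (m + 1, (R i).hump)} :=
    biSup_mono fun _ => Or.inl
  refine MeasurableSet.inter (measurableSet_coordSigma_occurrence fun p hp => ?_)
    (hle _ (measurableSet_coordSigma_noHit C m))
  exact (mem_occurrencePositions.1 hp).symm.imp_left le_of_eq

/-- Given the overlap, the entry at row `R.hump` and time `m + 1` is already right when `R` has
occurred at time `m`. -/
theorem occurrence_inter_occurrence_succ (h : R'.entry R.hump 0 = R.entry R.hump 1) :
    occurrence U R m ∩ occurrence U R' (m + 1) = occurrence U R m ∩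
      cylinder (Function.uncurry U)
        ((occurrencePositions R'.hump (m + 1)).erase (m + 1, R.hump))
        (occurrenceValue R' (m + 1)) := by
  ext ω
  refine and_congr_right fun hω => ?_
  have hvalue : U (m + 1) R.hump ω = occurrenceValue R' (m + 1) (m + 1, R.hump) := by
    rw [(mem_occurrence_iff.1 hω).2, occurrenceValue, if_pos rfl, h]
  rw [occurrence_eq_cylinder, mem_cylinder, mem_cylinder]
  refine ⟨fun hR' p hp => hR' p (Finset.mem_of_mem_erase hp), fun hR' p hp => ?_⟩
  obtain rfl | hne := eq_or_ne p (m + 1, R.hump)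
  exacts [hvalue, hR' p (Finset.mem_erase.2 ⟨hne, hp⟩)]

namespace IsUniformArray

variable [MeasurableSpace Ω] {μ : Measure Ω} (hU : IsUniformArray μ N U)

include hU

theorem measurable_uncurry (p : ℕ × Fin k) : Measurable (Function.uncurry U p) :=
  hU.measurable p.1 p.2

theorem measurableSet_occurrence (R : Pattern M k) (m : ℕ) : MeasurableSet (occurrence U R m) :=
  coordSigma_le hU.measurable_uncurry Set.univ _
    (measurableSet_coordSigma_occurrence fun _ _ => trivial)

theorem measureReal_cylinder_occurrenceValue (hMN : M ≤ N) (R : Pattern M k) (m : ℕ)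
    (P : Finset (ℕ × Fin k)) :
    μ.real (cylinder (Function.uncurry U) P (occurrenceValue R m)) = (N : ℝ)⁻¹ ^ P.card :=
  measureReal_cylinder hU.indep fun p _ => hU.measureReal_preimage_singleton p.1 p.2
    (Set.Icc_subset_Icc_right hMN (occurrenceValue_mem_Icc p))

theorem measureReal_occurrence (hMN : M ≤ N) (R : Pattern M k) (m : ℕ) :
    μ.real (occurrence U R m) = (N : ℝ)⁻¹ ^ (k + 1) := by
  rw [occurrence_eq_cylinder, hU.measureReal_cylinder_occurrenceValue hMN,
    card_occurrencePositions]

theorem measureReal_noHit_inter_occurrence_succ (hMN : M ≤ N) (R : ι → Pattern M k)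
    (C : Finset ι) (j : ι) (m : ℕ) :
    μ.real (noHit (fun i => occurrence U (R i)) C m ∩ occurrence U (R j) (m + 1)) =
      μ.real (noHit (fun i => occurrence U (R i)) C m) * (N : ℝ)⁻¹ ^ (k + 1) := by
  have hdisj : Disjoint {p : ℕ × Fin k | p.1 ≤ m} {p | m < p.1} :=
    Set.disjoint_left.2 fun _ (h : _ ≤ m) => h.not_gt
  rw [measureReal_inter_of_disjoint_coord hU.measurable_uncurry hU.indep hdisj
      (measurableSet_coordSigma_noHit C m) (measurableSet_coordSigma_occurrence fun _ =>
        le_fst_of_mem_occurrencePositions),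
    hU.measureReal_occurrence hMN]

theorem measureReal_firstHit_inter_occurrence_succ (hMN : M ≤ N) {R : ι → Pattern M k}
    (C : Finset ι) {i j : ι} (m : ℕ) (hij : (overlapGraph R).Adj j i) :
    μ.real (firstHit (fun i => occurrence U (R i)) C i m ∩ occurrence U (R j) (m + 1)) =
      (N : ℝ)⁻¹ ^ k * μ.real (firstHit (fun i => occurrence U (R i)) C i m) := by
  let P := (occurrencePositions (R j).hump (m + 1)).erase (m + 1, (R i).hump)
  have hmem : (m + 1, (R i).hump) ∈ occurrencePositions (R j).hump (m + 1) :=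
    mem_occurrencePositions.2 (.inr rfl)
  have hcard : P.card = k := by
    rw [Finset.card_erase_of_mem hmem, card_occurrencePositions, Nat.add_sub_cancel]
  have hdisj : Disjoint {p | p.1 ≤ m ∨ p = (m + 1, (R i).hump)}
      {p | m < p.1 ∧ p ≠ (m + 1, (R i).hump)} :=
    Set.disjoint_left.2 fun _ hp hp' => hp.elim hp'.1.not_ge hp'.2
  have hrest : MeasurableSet[coordSigma (Function.uncurry U)
      {p | m < p.1 ∧ p ≠ (m + 1, (R i).hump)}]
      (cylinder (Function.uncurry U) P (occurrenceValue (R j) (m + 1))) := by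
    refine measurableSet_coordSigma_cylinder (fun p hp => ?_) _
    obtain ⟨hne, hp⟩ := Finset.mem_erase.1 hp
    exact ⟨le_fst_of_mem_occurrencePositions hp, hne⟩
  have hinter : firstHit (fun i => occurrence U (R i)) C i m ∩ occurrence U (R j) (m + 1) =
      firstHit (fun i => occurrence U (R i)) C i m ∩
        cylinder (Function.uncurry U) P (occurrenceValue (R j) (m + 1)) := by
    rw [firstHit, Set.inter_right_comm, occurrence_inter_occurrence_succ hij,
      Set.inter_right_comm]
  rw [hinter, measureReal_inter_of_disjoint_coord hU.measurable_uncurry hU.indep hdisj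
    (measurableSet_coordSigma_firstHit C i m) hrest, hU.measureReal_cylinder_occurrenceValue hMN,
    hcard, mul_comm]

theorem isRenewalFamily_occurrence (hMN : M ≤ N) {R : ι → Pattern M k}
    (hR : Function.Injective fun i r => (R i).entry r 0) :
    IsRenewalFamily μ (fun i => occurrence U (R i)) (overlapGraph R)
      ((N : ℝ)⁻¹ ^ (k + 1)) ((N : ℝ)⁻¹ ^ k) where
  measurableSet i := hU.measurableSet_occurrence (R i)
  pairwise_disjoint _ _ _ hij := disjoint_occurrence (hR.ne hij)
  measureReal_zero i := hU.measureReal_occurrence hMN (R i) 0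
  measureReal_noHit_inter := hU.measureReal_noHit_inter_occurrence_succ hMN R
  measureReal_firstHit_inter C _ _ := hU.measureReal_firstHit_inter_occurrence_succ hMN C
  disjoint_succ _ := disjoint_occurrence_succ

end IsUniformArray

end Occurrence

section GeneratedPattern

variable {n : ℕ} (G : Digraph (Fin n))

theorem hump_generatedPattern (l : Fin n) : (generatedPattern G l).hump = l.succ :=
  ((generatedPattern G l).eq_hump (by simp [generatedPattern, generatedEntry])).symm

theorem injective_fst_generatedPattern :
    Function.Injective fun l r => (generatedPattern G l).entry r 0 := fun i j hij =>
  Fin.ext (by simpa [generatedPattern, generatedEntry] using congrFun hij 0)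

theorem overlapGraph_generatedPattern : overlapGraph (generatedPattern G) = G := by
  ext j i
  have hi : n ≠ i := i.isLt.ne'
  simp only [overlapGraph, hump_generatedPattern]
  by_cases hji : G.Adj j i <;> simp [generatedPattern, generatedEntry, hji, hi]

end GeneratedPattern

end PatternRank

theorem theorem4p5_general {Ω ι : Type*} [DecidableEq ι] [MeasurableSpace Ω] (μ : Measure Ω)
    [IsProbabilityMeasure μ] {M N k : ℕ} (hN : 1 < N) (hMN : M ≤ N)
    (R : ι → PatternRank.Pattern M k) (hR : Function.Injective fun i r => (R i).entry r 0)
    (hloop : ∀ i, ¬ (PatternRank.overlapGraph R).Adj i i)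
    (U : ℕ → Fin k → Ω → ℕ) (hU : PatternRank.IsUniformArray μ N U)
    (T : ι → Ω → ℕ∞) (hT : ∀ i, T i = PatternRank.patternTime U (R i)) :
    (∀ i j, IdentDistrib (T i) (T j) μ μ) ∧
      PatternRank.NoTie μ T Set.univ ∧
      PatternRank.IsTwoDetermined μ T := by
  obtain rfl : T = fun i => PatternRank.firstTime (PatternRank.occurrence U (R i)) :=
    funext fun i => (hT i).trans PatternRank.patternTime_eq_firstTime
  have hE := hU.isRenewalFamily_occurrence hMN hR
  have hp : (0 : ℝ) < (N : ℝ)⁻¹ ^ (k + 1) := by positivity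
  have hq : (0 : ℝ) < (N : ℝ)⁻¹ ^ k := by positivity
  refine ⟨fun i j => hE.identDistrib hp (hloop i) (hloop j), hE.noTie hp _, fun A B hA => ?_⟩
  obtain ⟨i, -⟩ := id hA
  have hq1 : (N : ℝ)⁻¹ ^ k < 1 :=
    pow_lt_one₀ (by positivity) (inv_lt_one_of_one_lt₀ (mod_cast hN)) (R i).hump.pos.ne'
  exact (hE.isBalanced hp).isTwoDetermined hE.measurable_firstTime (hE.noTie hp _) hloop hq hq1
    A B hA

theorem theorem4p5 {Ω : Type*} [MeasurableSpace Ω] (μ : Measure Ω) [IsProbabilityMeasure μ]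
    (n N : ℕ) (hn : 2 ≤ n) (hN : n + 1 ≤ N)
    (G : Digraph (Fin n)) (hG : PatternRank.IsOriented G)
    (U : ℕ → Fin (n + 1) → Ω → ℕ) (hU : PatternRank.IsUniformArray μ N U)
    (T : Fin n → Ω → ℕ∞)
    (hT : ∀ i, T i = PatternRank.patternTime U (PatternRank.generatedPattern G i)) :
    (∀ i j, IdentDistrib (T i) (T j) μ μ) ∧
      PatternRank.NoTie μ T Set.univ ∧
      PatternRank.IsTwoDetermined μ T := by
  have hloop : ∀ i, ¬ (PatternRank.overlapGraph (PatternRank.generatedPattern G)).Adj i i := by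
    simpa only [PatternRank.overlapGraph_generatedPattern] using fun i hi => hG i i hi hi
  exact theorem4p5_general μ (by omega) hN _ (PatternRank.injective_fst_generatedPattern G) hloop
    U hU T hT
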